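/- Let $D$ be a division ring with center $F$ and multiplicative group $D^* = D\setminus\{0\}$. Suppose that $D$ is weakly locally finite, i.e. for every finite subset $S\subseteq D$, the division subring $L$ of $D$ generated by $S$ is a finite-dimensional vector space over its own center $Z(L)$. Let $N$ be a subnormal subgroup of $D^*$. If $N$ is radical over $F$, i.e. for every $x\in N$ there is a positive integer $n(x)$, depending on $x$, such that $x^{n(x)}\in F$, then $N$ is central, i.e. $N\subseteq F$. -/

import Mathlib

/-- A division ring `D` is centrally finite if it is a finite-dimensional vector space over its
center. -/
def IsCentrallyFinite (D : Type*) [DivisionRing D] : Prop :=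
  Module.Finite (Subring.center D) D

/-- A division ring `D` is weakly locally finite if for every finite subset `S` of `D`, the division
subring of `D` generated by `S` is centrally finite (over its own center). Mathlib's `Subfield D`,
for a division ring `D`, is the type of division subrings of `D`, not assumed commutative. -/
def IsWeaklyLocallyFinite (D : Type*) [DivisionRing D] : Prop :=
  ∀ S : Finset D, IsCentrallyFinite (Subfield.closure (S : Set D))

/-- A subset `S` of `D` is radical over a subring `K` of `D` if every element of `S` has some
positive power, with exponent depending on the element, lying in `K`. -/
def IsRadicalOver {D : Type*} [DivisionRing D] (S : Set D) (K : Subring D) : Prop :=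
  ∀ x ∈ S, ∃ n : ℕ, 0 < n ∧ x ^ n ∈ K

/-! Given `x ∈ N` and `y ∈ D`, work in the division subring generated by both, finite-dimensional
over its center `F`. Subnormality puts an iterated commutator `⁅x, ⁅x, …, g⁆⁆` of fixed depth in
`N`, so it is radical; a radical commutator has norm 1, so it is torsion. If `F` has a nontrivial
valuation, the regular representation gives an ultrametric norm. For `g = 1 + t • a` with `t` small,
all these commutators are close to 1, where the only torsion element is 1 (`eq_one_of_pow_eq_one`).
So a deep commutator is trivial, and radicality of `x` peels off one level at a time
(`commute_of_iterate_commutator_eq_one`) until `x` commutes with `a`. Otherwise `F` is algebraic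
over a finite field, and Wedderburn's little theorem gives commutativity. -/

open Finset commutatorElement

/-- A submultiplicative ultrametric norm on an `F`-algebra, compatible with a valuation on `F`. -/
structure UltrametricAlgebraNorm {F Γ₀ : Type*} [Field F] [LinearOrderedCommGroupWithZero Γ₀]
    (v : Valuation F Γ₀) (D : Type*) [Ring D] [Algebra F D] where
  toFun : D → Γ₀
  sub_le : ∀ a b, toFun (a - b) ≤ max (toFun a) (toFun b)
  mul_le : ∀ a b, toFun (a * b) ≤ toFun a * toFun b
  one_le : toFun 1 ≤ 1
  eq_zero : ∀ a, toFun a = 0 → a = 0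
  smul : ∀ (t : F) a, toFun (t • a) = v t * toFun a

namespace UltrametricAlgebraNorm

/-! ### Existence of ultrametric norms -/

section Exists

variable {F Γ₀ ι : Type*} [Field F] [LinearOrderedCommGroupWithZero Γ₀] [Fintype ι]

/-- The maximum of the valuations of the entries of a square matrix. -/
noncomputable def entrySup (v : Valuation F Γ₀) (A : Matrix ι ι F) : Γ₀ :=
  univ.sup fun p : ι × ι => v (A p.1 p.2)

lemma entrySup_le_iff (v : Valuation F Γ₀) (A : Matrix ι ι F) (γ : Γ₀) :
    entrySup v A ≤ γ ↔ ∀ i j, v (A i j) ≤ γ := by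
  simp [entrySup, Finset.sup_le_iff]

lemma le_entrySup (v : Valuation F Γ₀) (A : Matrix ι ι F) (i j : ι) :
    v (A i j) ≤ entrySup v A :=
  (entrySup_le_iff v A _).1 le_rfl i j

/-- The maximum of the valuations of the entries is an ultrametric norm on square matrices. -/
noncomputable def ofMatrix [DecidableEq ι] (v : Valuation F Γ₀) :
    UltrametricAlgebraNorm v (Matrix ι ι F) where
  toFun := entrySup v
  sub_le A B := (entrySup_le_iff _ _ _).2 fun i j => (v.map_sub _ _).trans
    (max_le_max (le_entrySup v A i j) (le_entrySup v B i j))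
  mul_le A B := (entrySup_le_iff _ _ _).2 fun i j => by
    rw [Matrix.mul_apply]
    refine v.map_sum_le fun k _ => ?_
    rw [map_mul]
    exact mul_le_mul' (le_entrySup v A i k) (le_entrySup v B k j)
  one_le := (entrySup_le_iff _ _ _).2 fun i j => by
    rw [Matrix.one_apply]; split_ifs <;> simp
  eq_zero A h := by
    ext i j
    have := le_entrySup v A i j
    rw [h] at this
    simpa using this
  smul t A := by
    refine le_antisymm ((entrySup_le_iff _ _ _).2 fun i j => ?_) ?_
    · simpa using mul_le_mul_right (le_entrySup v A i j) (v t)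
    · by_cases ht : t = 0
      · simp [ht]
      have hv : 0 < v t := zero_lt_iff.2 (by simpa using ht)
      rw [mul_comm, ← le_div_iff₀ hv, entrySup_le_iff]
      intro i j
      rw [le_div_iff₀ hv, mul_comm, ← map_mul]
      exact le_entrySup v (t • A) i j

/-- Restriction of a norm along an injective algebra homomorphism. -/
def comap {v : Valuation F Γ₀} {D E : Type*} [Ring D] [Algebra F D] [Ring E] [Algebra F E]
    (ν : UltrametricAlgebraNorm v E) (f : D →ₐ[F] E) (hf : Function.Injective f) :
    UltrametricAlgebraNorm v D where
  toFun a := ν.toFun (f a)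
  sub_le a b := by rw [map_sub]; exact ν.sub_le _ _
  mul_le a b := by rw [map_mul]; exact ν.mul_le _ _
  one_le := by rw [map_one]; exact ν.one_le
  eq_zero a h := (map_eq_zero_iff f hf).1 (ν.eq_zero _ h)
  smul t a := by rw [map_smul]; exact ν.smul _ _

lemma nonempty_of_finite (v : Valuation F Γ₀) (D : Type*) [Ring D] [Algebra F D]
    [Module.Finite F D] : Nonempty (UltrametricAlgebraNorm v D) :=
  let b := Module.finBasis F D
  ⟨(ofMatrix v).comap (Algebra.leftMulMatrix b) (Algebra.leftMulMatrix_injective b)⟩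

end Exists

/-! ### Estimates near 1 -/

section Ring

variable {F Γ₀ D : Type*} [Field F] [LinearOrderedCommGroupWithZero Γ₀] {v : Valuation F Γ₀}
  [Ring D] [Algebra F D] (ν : UltrametricAlgebraNorm v D)

lemma map_zero' : ν.toFun 0 = 0 := by
  simpa using ν.smul 0 0

lemma map_neg' (a : D) : ν.toFun (-a) = ν.toFun a := by
  simpa using ν.smul (-1) a

lemma add_le (a b : D) : ν.toFun (a + b) ≤ max (ν.toFun a) (ν.toFun b) := by
  simpa [ν.map_neg'] using ν.sub_le a (-b)

lemma map_natCast_mul (n : ℕ) (a : D) : ν.toFun (n * a) = v n * ν.toFun a := by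
  rw [← ν.smul, Algebra.smul_def, map_natCast]

lemma le_one_of_sub_one {c : D} (hc : ν.toFun (c - 1) ≤ 1) : ν.toFun c ≤ 1 := by
  have := ν.add_le (c - 1) 1
  rw [sub_add_cancel] at this
  exact this.trans (max_le hc ν.one_le)

lemma pow_sub_one_le {c : D} (hc : ν.toFun (c - 1) ≤ 1) (n : ℕ) :
    ν.toFun (c ^ n - 1) ≤ ν.toFun (c - 1) := by
  induction n with
  | zero => simp [ν.map_zero']
  | succ n ih =>
    have e : c ^ (n + 1) - 1 = (c ^ n - 1) * c + (c - 1) := by rw [pow_succ]; noncomm_ring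
    rw [e]
    refine (ν.add_le _ _).trans (max_le ((ν.mul_le _ _).trans ?_) le_rfl)
    exact (mul_le_mul' ih (ν.le_one_of_sub_one hc)).trans_eq (mul_one _)

lemma pow_sub_one_sub_natCast_mul_le {c : D} (hc : ν.toFun (c - 1) ≤ 1) (n : ℕ) :
    ν.toFun (c ^ n - 1 - n * (c - 1)) ≤ ν.toFun (c - 1) * ν.toFun (c - 1) := by
  induction n with
  | zero => simp [ν.map_zero']
  | succ n ih =>
    have e : c ^ (n + 1) - 1 - (n + 1 : ℕ) * (c - 1) =
        (c ^ n - 1 - n * (c - 1)) + (c ^ n - 1) * (c - 1) := by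
      rw [pow_succ]; push_cast; noncomm_ring
    rw [e]
    refine (ν.add_le _ _).trans (max_le ih ((ν.mul_le _ _).trans ?_))
    exact mul_le_mul' (ν.pow_sub_one_le hc n) le_rfl

/-- A nontrivial `n`-torsion element cannot be closer to `1` than the valuation of `n`. -/
lemma natCast_le_of_pow_eq_one {c : D} {n : ℕ} (hc : ν.toFun (c - 1) ≤ 1) (hn : c ^ n = 1)
    (h1 : c ≠ 1) : v n ≤ ν.toFun (c - 1) := by
  have h := ν.pow_sub_one_sub_natCast_mul_le hc n
  rw [hn, sub_self, zero_sub, ν.map_neg', ν.map_natCast_mul] at h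
  have hpos : 0 < ν.toFun (c - 1) :=
    zero_lt_iff.2 fun h0 => h1 (sub_eq_zero.1 (ν.eq_zero _ h0))
  exact le_of_mul_le_mul_right h hpos

/-- In `h = 1 - (g - 1) * h` the last term is smaller than `h`, so a value above 1 is impossible. -/
lemma le_one_of_mul_eq_one {g h : D} (hg : ν.toFun (g - 1) < 1) (hgh : g * h = 1) :
    ν.toFun h ≤ 1 := by
  by_contra! hh
  have e : h = 1 - (g - 1) * h := by rw [sub_mul, hgh]; simp
  have h2 : ν.toFun ((g - 1) * h) < ν.toFun h :=
    (ν.mul_le _ _).trans_lt (mul_lt_of_lt_one_left (zero_lt_one.trans hh) hg)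
  have h3 := ν.sub_le 1 ((g - 1) * h)
  rw [← e] at h3
  exact (max_lt (ν.one_le.trans_lt hh) h2).not_ge h3

/-- Commutation with `x` expands the distance to 1 by a factor depending on `x` alone, so boundedly
many iterations stay under control. -/
lemma commutator_sub_one_le (x g : Dˣ) (hg : ν.toFun (g - 1) < 1) :
    ν.toFun (((⁅x, g⁆ : Dˣ) : D) - 1) ≤
      max 1 (ν.toFun x * ν.toFun (x⁻¹ : Dˣ)) * ν.toFun (g - 1) := by
  have e : ((⁅x, g⁆ : Dˣ) : D) - 1 =
      (x * (g - 1) * (x⁻¹ : Dˣ) - (g - 1)) * (g⁻¹ : Dˣ) := by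
    simp [commutatorElement_def, mul_sub, sub_mul]
  rw [e]
  refine (ν.mul_le _ _).trans ?_
  refine (mul_le_mul' (ν.sub_le _ _) (ν.le_one_of_mul_eq_one hg g.mul_inv)).trans ?_
  rw [mul_one]
  refine max_le ?_ (le_mul_of_one_le_left' (le_max_left _ _))
  refine (ν.mul_le _ _).trans ((mul_le_mul' (ν.mul_le _ _) le_rfl).trans ?_)
  rw [mul_right_comm]
  exact mul_le_mul' (le_max_right _ _) le_rfl

lemma iterate_commutator_sub_one_le (x g : Dˣ) {C : Γ₀}
    (hC : C = max 1 (ν.toFun x * ν.toFun (x⁻¹ : Dˣ))) {k : ℕ}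
    (hg : C ^ k * ν.toFun (g - 1) < 1) {j : ℕ} (hj : j ≤ k) :
    ν.toFun ((((fun z => ⁅x, z⁆)^[j] g : Dˣ) : D) - 1) ≤ C ^ j * ν.toFun (g - 1) := by
  induction j with
  | zero => simp
  | succ j ih =>
    have ih := ih (by omega)
    have h1 : 1 ≤ C := hC ▸ le_max_left _ _
    have h2 : C ^ j * ν.toFun (g - 1) < 1 :=
      (mul_le_mul' (pow_le_pow_right₀ h1 (by omega)) le_rfl).trans_lt hg
    rw [Function.iterate_succ_apply', pow_succ', mul_assoc]
    refine (ν.commutator_sub_one_le x _ (ih.trans_lt h2)).trans ?_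
    rw [← hC]
    exact mul_le_mul' le_rfl ih

end Ring

section DivisionRing

variable {F Γ₀ D : Type*} [Field F] [LinearOrderedCommGroupWithZero Γ₀] {v : Valuation F Γ₀}
  [DivisionRing D] [Algebra F D] (ν : UltrametricAlgebraNorm v D)

/-- Some power of a nontrivial torsion `c` has prime order `q` and is no farther from 1, against
`natCast_le_of_pow_eq_one`. -/
lemma eq_one_of_pow_eq_one {ε : Γ₀} (hε1 : ε ≤ 1)
    (hε : ∀ q : ℕ, q.Prime → (q : F) ≠ 0 → ε ≤ v q) {c : D} (hc : ν.toFun (c - 1) < ε)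
    {n : ℕ} (hn : 0 < n) (hcn : c ^ n = 1) : c = 1 := by
  by_contra h1
  have hfin : IsOfFinOrder c := isOfFinOrder_iff_pow_eq_one.2 ⟨n, hn, hcn⟩
  obtain ⟨q, hq, hqd⟩ := Nat.exists_prime_and_dvd (n := orderOf c) (by simpa using h1)
  obtain ⟨m, hm⟩ := hqd
  have hm0 : 0 < m := by
    have := hfin.orderOf_pos
    rw [hm] at this
    exact pos_of_mul_pos_right this (Nat.zero_le _)
  have hb1 : c ^ m ≠ 1 := by
    intro h
    have := orderOf_le_of_pow_eq_one hm0 h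
    rw [hm] at this
    nlinarith [hq.two_le]
  have hbq : (c ^ m) ^ q = 1 := by rw [← pow_mul, mul_comm, ← hm, pow_orderOf_eq_one]
  by_cases hqF : (q : F) = 0
  -- In characteristic `q`, `(c ^ m - 1) ^ q = (c ^ m) ^ q - 1 = 0`.
  · have hqD : (q : D) = 0 := by
      rw [← map_natCast (algebraMap F D), hqF, map_zero]
    have : Fact q.Prime := ⟨hq⟩
    have : CharP D q := (CharP.charP_iff_prime_eq_zero hq).2 hqD
    have := sub_pow_char_of_commute (p := q) (Commute.one_right (c ^ m))
    rw [hbq, one_pow, sub_self] at this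
    exact hb1 (sub_eq_zero.1 (pow_eq_zero_iff hq.ne_zero |>.1 this))
  · have hle := ν.pow_sub_one_le (hc.le.trans hε1) m
    exact ((hε q hq hqF).trans
      (ν.natCast_le_of_pow_eq_one (hle.trans (hc.le.trans hε1)) hbq hb1)).not_gt
      (hle.trans_lt hc)

end DivisionRing

end UltrametricAlgebraNorm

/-- By Bézout, at most one prime has value below 1. -/
lemma Valuation.exists_pos_le_natCast_prime {F Γ₀ : Type*} [Field F]
    [LinearOrderedCommGroupWithZero Γ₀] (v : Valuation F Γ₀) :
    ∃ ε : Γ₀, 0 < ε ∧ ε ≤ 1 ∧ ∀ q : ℕ, q.Prime → (q : F) ≠ 0 → ε ≤ v q := by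
  have hint (z : ℤ) : v z ≤ 1 := by
    induction z using Int.induction_on with
    | zero => simp
    | succ n ih => push_cast at ih ⊢; exact (v.map_add _ _).trans (max_le ih (by simp))
    | pred n ih => push_cast at ih ⊢; exact (v.map_sub _ _).trans (max_le ih (by simp))
  by_cases h : ∃ l : ℕ, l.Prime ∧ (l : F) ≠ 0 ∧ v l < 1
  · obtain ⟨l, hl, hl0, hl1⟩ := h
    refine ⟨v l, zero_lt_iff.2 (by simpa using hl0), hl1.le, fun q hq _ => ?_⟩
    by_contra! hlt
    have hne : l ≠ q := by rintro rfl; exact lt_irrefl _ hlt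
    have hco : IsCoprime (l : ℤ) (q : ℤ) :=
      Nat.isCoprime_iff_coprime.2 ((Nat.coprime_primes hl hq).2 hne)
    obtain ⟨a, b, hab⟩ := hco
    have hab' : (a : F) * l + b * q = 1 := by exact_mod_cast congrArg (Int.cast : ℤ → F) hab
    have h1 : v ((a : F) * l + b * q) < 1 := by
      refine (v.map_add _ _).trans_lt (max_lt ?_ ?_) <;> rw [map_mul]
      · exact (mul_le_mul' (hint a) le_rfl).trans_lt (by simpa using hl1)
      · exact (mul_le_mul' (hint b) le_rfl).trans_lt (by simpa using hlt.trans hl1)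
    rw [hab', map_one] at h1
    exact lt_irrefl _ h1
  · push Not at h
    exact ⟨1, zero_lt_one, le_rfl, h⟩

section Torsion

variable {F D : Type*} [Field F] [DivisionRing D] [Algebra F D] [Module.Finite F D]

/-- A commutator that is radical over the base field has norm `1`, hence is torsion. -/
lemma exists_commutator_pow_eq_one (x g : Dˣ) {n : ℕ} (hn : 0 < n)
    (h : ((⁅x, g⁆ : Dˣ) : D) ^ n ∈ (algebraMap F D).range) :
    ∃ m : ℕ, 0 < m ∧ ((⁅x, g⁆ : Dˣ) : D) ^ m = 1 := by
  obtain ⟨l, hl⟩ := h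
  have h1 : Algebra.norm F ((⁅x, g⁆ : Dˣ) : D) = 1 := by
    have : Units.map (Algebra.norm F : D →* F) ⁅x, g⁆ = 1 := by
      rw [map_commutatorElement, commutatorElement_eq_one_iff_mul_comm, mul_comm]
    exact congrArg Units.val this
  have h2 : l ^ Module.finrank F D = 1 := by
    have := Algebra.norm_algebraMap_of_basis (Module.finBasis F D) l
    rwa [hl, map_pow, h1, one_pow, Fintype.card_fin, eq_comm] at this
  refine ⟨n * Module.finrank F D, Nat.mul_pos hn Module.finrank_pos, ?_⟩
  rw [pow_mul, ← hl, ← map_pow, h2, map_one]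

end Torsion

lemma pow_mul_mul_inv_pow_of_commute {G : Type*} [Group G] {x h : G} (hc : Commute x ⁅x, h⁆)
    (n : ℕ) : x ^ n * h * (x ^ n)⁻¹ = ⁅x, h⁆ ^ n * h := by
  induction n with
  | zero => simp
  | succ n ih =>
    have e : x * h * x⁻¹ = ⁅x, h⁆ * h := by simp [commutatorElement_def]
    calc x ^ (n + 1) * h * (x ^ (n + 1))⁻¹ = x * (x ^ n * h * (x ^ n)⁻¹) * x⁻¹ := by
          rw [pow_succ']; group
      _ = (x * ⁅x, h⁆ ^ n) * h * x⁻¹ := by rw [ih]; group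
      _ = ⁅x, h⁆ ^ n * (x * h * x⁻¹) := by rw [(hc.pow_right n).eq]; group
      _ = ⁅x, h⁆ ^ (n + 1) * h := by rw [e, pow_succ, mul_assoc]

namespace UltrametricAlgebraNorm

variable {F Γ₀ D : Type*} [Field F] [LinearOrderedCommGroupWithZero Γ₀] {v : Valuation F Γ₀}
  [DivisionRing D] [Algebra F D]

/-- If a high iterated commutator `⁅x, ⁅x, …, ⁅x, g⁆⁆⁆` with a radical element `x` is trivial and
`g` is close to `1`, then already `⁅x, g⁆` is trivial. -/
lemma commute_of_iterate_commutator_eq_one (ν : UltrametricAlgebraNorm v D) {ε : Γ₀} (hε1 : ε ≤ 1)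
    (hε : ∀ q : ℕ, q.Prime → (q : F) ≠ 0 → ε ≤ v q) {x g : Dˣ} {n : ℕ} (hn : 0 < n)
    (hx : (x : D) ^ n ∈ Subring.center D) {k : ℕ}
    (hclose : ∀ j ≤ k, ν.toFun ((((fun z => ⁅x, z⁆)^[j] g : Dˣ) : D) - 1) < ε)
    (h1 : (fun z => ⁅x, z⁆)^[k + 1] g = 1) : Commute x g := by
  induction k with
  | zero => exact commutatorElement_eq_one_iff_mul_comm.1 h1
  | succ k ih =>
    refine ih (fun j hj => hclose j (by omega)) ?_
    have hk := hclose (k + 1) le_rfl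
    rw [Function.iterate_succ_apply'] at h1 hk ⊢
    rw [Function.iterate_succ_apply'] at h1
    set h := (fun z => ⁅x, z⁆)^[k] g with hh
    have hc : Commute x ⁅x, h⁆ := commutatorElement_eq_one_iff_mul_comm.1 h1
    have e := pow_mul_mul_inv_pow_of_commute hc n
    -- Since `x ^ n` is central, `e` becomes `⁅x, h⁆ ^ n = 1`: torsion close to 1.
    have hxn : x ^ n * h = h * x ^ n := by
      ext
      simpa using (Subring.mem_center_iff.1 hx h).symm
    rw [hxn, mul_inv_cancel_right, eq_comm, mul_eq_right] at e
    ext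
    refine ν.eq_one_of_pow_eq_one hε1 hε hk hn ?_
    simpa using congrArg Units.val e

end UltrametricAlgebraNorm

/-! ### The centrally finite case -/

section Center

variable {F D : Type*} [Field F] [DivisionRing D] [Algebra F D] [Module.Finite F D]

lemma mem_center_of_valuationSubring (hF : (algebraMap F D).range = Subring.center D)
    (V : ValuationSubring F) {s : F} (hs : s ∉ V) (x : Dˣ) {n : ℕ} (hn : 0 < n)
    (hx : (x : D) ^ n ∈ Subring.center D) (r : ℕ)
    (hr : ∀ g : Dˣ, ∃ m : ℕ, 0 < m ∧ (((fun z => ⁅x, z⁆)^[r] g : Dˣ) : D) ^ m ∈ Subring.center D) :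
    (x : D) ∈ Subring.center D := by
  rw [Subring.mem_center_iff]
  intro a
  have hs1 : 1 < V.valuation s := by
    rw [← V.valuation_le_one_iff] at hs
    exact not_le.1 hs
  obtain ⟨ν⟩ := UltrametricAlgebraNorm.nonempty_of_finite V.valuation D
  obtain ⟨ε, hε0, hε1, hε⟩ := V.valuation.exists_pos_le_natCast_prime
  obtain ⟨C, hC⟩ : ∃ C, C = max 1 (ν.toFun x * ν.toFun (x⁻¹ : Dˣ)) := ⟨_, rfl⟩
  have hC1 : 1 ≤ C := hC ▸ le_max_left _ _
  obtain ⟨M, hM⟩ : ∃ M, M = C ^ (r + 1) * max 1 (ν.toFun a) := ⟨_, rfl⟩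
  have hM0 : 0 < M := by
    rw [hM]
    exact mul_pos (pow_pos (zero_lt_one.trans_le hC1) _) (zero_lt_one.trans_le (le_max_left _ _))
  obtain ⟨t, ht0, ht⟩ : ∃ t : F, t ≠ 0 ∧ V.valuation t * M < ε := by
    obtain ⟨t, ht⟩ := V.valuation_surjective (ε / M)
    have hs0 : 0 < V.valuation s := zero_lt_one.trans hs1
    -- Here `t` has value exactly `ε / M`; dividing by `s`, of value above 1, makes the bound
    -- strict.
    refine ⟨t / s, ?_, ?_⟩
    · rw [← V.valuation.ne_zero_iff, map_div₀, ht]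
      exact div_ne_zero (div_ne_zero hε0.ne' hM0.ne') hs0.ne'
    · rw [map_div₀, ht, div_mul_eq_mul_div, div_mul_cancel₀ _ hM0.ne']
      exact (div_lt_iff₀ hs0).2 (lt_mul_of_one_lt_right hε0 hs1)
  suffices h : Commute (x : D) (1 + t • a) by
    have h2 : Commute (x : D) (t • a) := by
      simpa using h.sub_right (Commute.one_right _)
    exact ((Commute.smul_right_iff₀ ht0).1 h2).symm.eq
  by_cases hg0 : 1 + t • a = 0
  · rw [hg0]; exact Commute.zero_right _
  obtain ⟨g, hg⟩ : ∃ g : Dˣ, (g : D) = 1 + t • a := ⟨Units.mk0 _ hg0, rfl⟩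
  have hgν : C ^ (r + 1) * ν.toFun (g - 1) < ε := by
    rw [hg, add_sub_cancel_left, ν.smul, mul_left_comm]
    refine (mul_le_mul' le_rfl ?_).trans_lt ht
    rw [hM]
    exact mul_le_mul' le_rfl (le_max_right _ _)
  have hclose : ∀ j ≤ r + 1, ν.toFun ((((fun z => ⁅x, z⁆)^[j] g : Dˣ) : D) - 1) < ε := by
    intro j hj
    refine (ν.iterate_commutator_sub_one_le x g hC (hgν.trans_le hε1) hj).trans_lt
      ((mul_le_mul' ?_ le_rfl).trans_lt hgν)
    exact pow_le_pow_right₀ hC1 hj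
  rw [← hg]
  suffices Commute x g from congrArg Units.val this.eq
  refine ν.commute_of_iterate_commutator_eq_one hε1 hε hn hx (k := r)
    (fun j hj => hclose j (by omega)) ?_
  -- Starting from `⁅x, g⁆` makes the radical element a commutator even when `r = 0`.
  obtain ⟨m, hm, hmc⟩ := hr ⁅x, g⁆
  have hcr := hclose (r + 1) le_rfl
  rw [← Function.iterate_succ_apply (fun z => ⁅x, z⁆), Function.iterate_succ_apply'] at hmc
  rw [Function.iterate_succ_apply'] at hcr ⊢
  obtain ⟨m', hm', h1⟩ := exists_commutator_pow_eq_one (F := F) x _ hm (hF ▸ hmc)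
  ext
  exact ν.eq_one_of_pow_eq_one hε1 hε hcr hm' h1

/-- A division ring that is finite-dimensional over a central field which has positive
characteristic and is integral over `ℤ` is commutative. -/
lemma mul_comm_of_isIntegral {p : ℕ} [Fact p.Prime] [CharP F p]
    (hint : ∀ z : F, IsIntegral ℤ z) (x y : D) : x * y = y * x := by
  let := ZMod.algebra F p
  have hint' (z : F) : IsIntegral (ZMod p) z := (hint z).tower_top
  let b := Module.finBasis F D
  let f := Algebra.leftMulMatrix b
  let S : Set F := Set.range (fun q : Fin (Module.finrank F D) × Fin (Module.finrank F D) =>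
    f x q.1 q.2) ∪ Set.range (fun q : Fin (Module.finrank F D) × Fin (Module.finrank F D) =>
    f y q.1 q.2)
  have hS : S.Finite := (Set.finite_range _).union (Set.finite_range _)
  let R₀ := Algebra.adjoin (ZMod p) S
  have hfg : Module.Finite (ZMod p) R₀ :=
    Module.Finite.iff_fg.2 (fg_adjoin_of_finite hS fun z _ => hint' z)
  have hfin : Finite R₀ := Module.finite_of_finite (ZMod p)
  -- Elements whose matrices have entries in the finite ring `R₀`: a finite domain containing `x`
  -- and `y`.
  let T : Subring D := (R₀.val.toRingHom.mapMatrix.range).comap f.toRingHom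
  have hTfin : Finite T := by
    have : Finite (R₀.val.toRingHom.mapMatrix (m := Fin (Module.finrank F D))).range := by
      exact Set.finite_range _
    refine Finite.of_injective (fun z : T => (⟨f z, z.2⟩ :
      (R₀.val.toRingHom.mapMatrix (m := Fin (Module.finrank F D))).range)) ?_
    intro z w h
    exact Subtype.ext (Algebra.leftMulMatrix_injective b (congrArg Subtype.val h))
  have hmem (z : D) (hz : ∀ i j, f z i j ∈ S) : z ∈ T :=
    ⟨Matrix.of fun i j => ⟨f z i j, Algebra.subset_adjoin (hz i j)⟩, by ext; rfl⟩
  have hx : x ∈ T := hmem x fun i j => Or.inl ⟨(i, j), rfl⟩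
  have hy : y ∈ T := hmem y fun i j => Or.inr ⟨(i, j), rfl⟩
  exact congrArg Subtype.val ((Finite.isDomain_to_isField T).mul_comm ⟨x, hx⟩ ⟨y, hy⟩)

lemma mem_center_of_iterate_commutator (hF : (algebraMap F D).range = Subring.center D)
    (x : Dˣ) {n : ℕ} (hn : 0 < n) (hx : (x : D) ^ n ∈ Subring.center D) (r : ℕ)
    (hr : ∀ g : Dˣ, ∃ m : ℕ, 0 < m ∧ (((fun z => ⁅x, z⁆)^[r] g : Dˣ) : D) ^ m ∈ Subring.center D) :
    (x : D) ∈ Subring.center D := by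
  by_cases h : ∃ (V : ValuationSubring F) (s : F), s ∉ V
  · obtain ⟨V, s, hs⟩ := h
    exact mem_center_of_valuationSubring hF V hs x hn hx r hr
  push Not at h
  have hint (z : F) : IsIntegral ℤ z := by
    -- An integral closure in a field is the intersection of the valuation rings above it, here all
    -- equal to `F`.
    have hz : z ∈ (integralClosure (Subring.closure (∅ : Set F)) F).toSubring := by
      rw [← iInf_valuationSubring_superset]
      simp [Subring.mem_iInf, h]
    have : Algebra.IsIntegral ℤ (Subring.closure (∅ : Set F)) := by
      refine ⟨fun w => ?_⟩
      obtain ⟨m, hm⟩ := Subring.mem_bot.1 (Subring.closure_empty (R := F).le w.2)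
      have : w = algebraMap ℤ _ m := Subtype.ext (by simp [← hm])
      exact this ▸ isIntegral_algebraMap
    exact isIntegral_trans (A := Subring.closure (∅ : Set F)) z hz
  obtain ⟨p, hp⟩ := CharP.exists F
  obtain hpp | rfl := CharP.char_is_prime_or_zero F p
  · have : Fact p.Prime := ⟨hpp⟩
    exact Subring.mem_center_iff.2 fun y => mul_comm_of_isIntegral (p := p) hint y x
  · have := CharP.charP_to_charZero F
    -- In characteristic zero, `1 / 2` would be an integer.
    have h2 := hint (algebraMap ℚ F (1 / 2))
    rw [isIntegral_algebraMap_iff (algebraMap ℚ F).injective,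
      IsIntegrallyClosed.isIntegral_iff] at h2
    obtain ⟨m, hm⟩ := h2
    have hm' : (m : ℚ) * 2 = 1 := by
      rw [← eq_intCast (algebraMap ℤ ℚ), hm]; norm_num
    have : m * 2 = 1 := by exact_mod_cast hm'
    omega

end Center

/-- Iterated commutators with an element of a subnormal subgroup eventually lie in it. -/
lemma Subgroup.IsSubnormal.exists_iterate_commutator_mem {G : Type*} [Group G] {N : Subgroup G}
    (hN : N.IsSubnormal) : ∃ r : ℕ, ∀ x ∈ N, ∀ g : G, (fun z => ⁅x, z⁆)^[r] g ∈ N := by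
  induction hN with
  | top => exact ⟨0, fun _ _ _ => Subgroup.mem_top _⟩
  | step H K hle _ hn ih =>
    obtain ⟨r, hr⟩ := ih
    refine ⟨r + 1, fun x hx g => ?_⟩
    rw [Function.iterate_succ_apply']
    have hk := hr x (hle hx) g
    -- With `k` the previous iterate, `⁅x, k⁆ = x * (k * x⁻¹ * k⁻¹)`, and `H` is normal in `K ∋ k`.
    have := hn.conj_mem ⟨x⁻¹, hle (H.inv_mem hx)⟩ (H.inv_mem hx) ⟨_, hk⟩
    have h2 := H.mul_mem hx this
    simpa [commutatorElement_def, mul_assoc] using h2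

lemma IsCentrallyFinite.mem_center {D : Type*} [DivisionRing D] (hD : IsCentrallyFinite D)
    (x : Dˣ) {n : ℕ} (hn : 0 < n) (hx : (x : D) ^ n ∈ Subring.center D) (r : ℕ)
    (hr : ∀ g : Dˣ, ∃ m : ℕ, 0 < m ∧ (((fun z => ⁅x, z⁆)^[r] g : Dˣ) : D) ^ m ∈ Subring.center D) :
    (x : D) ∈ Subring.center D := by
  let : Algebra (Subring.center D) D :=
    Algebra.ofModule (fun r a b => by simp [Subring.smul_def, mul_assoc])
      (fun r a b => by
        simp only [Subring.smul_def, smul_eq_mul]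
        rw [← mul_assoc, Subring.mem_center_iff.1 r.2 a, mul_assoc])
  have : Module.Finite (Subring.center D) D := hD
  refine mem_center_of_iterate_commutator (F := Subring.center D) ?_ x hn hx r hr
  ext z
  constructor
  · rintro ⟨w, rfl⟩
    rw [Algebra.algebraMap_eq_smul_one]
    simp [Subring.smul_def]
  · intro hz
    exact ⟨⟨z, hz⟩, by rw [Algebra.algebraMap_eq_smul_one]; simp [Subring.smul_def]⟩

theorem theorem8p2 {D : Type*} [DivisionRing D] (hD : IsWeaklyLocallyFinite D)
    (N : Subgroup Dˣ) (hN : N.IsSubnormal)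
    (hrad : IsRadicalOver ((fun u : Dˣ => (u : D)) '' (N : Set Dˣ)) (Subring.center D)) :
    (fun u : Dˣ => (u : D)) '' (N : Set Dˣ) ⊆ (Subring.center D : Set D) := by
  classical
  rintro _ ⟨x, hx, rfl⟩
  rw [SetLike.mem_coe, Subring.mem_center_iff]
  intro y
  obtain ⟨r, hr⟩ := hN.exists_iterate_commutator_mem
  let L := Subfield.closure (({(x : D), y} : Finset D) : Set D)
  have hxL : (x : D) ∈ L := Subfield.subset_closure (by simp)
  have hyL : y ∈ L := Subfield.subset_closure (by simp)
  let ι : Lˣ →* Dˣ := Units.map (L.subtype : L →* D)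
  let x' : Lˣ := Units.mk0 ⟨x, hxL⟩ (by simp [Subtype.ext_iff])
  have hx' : ι x' = x := Units.ext rfl
  have hcenter (u : Lˣ) (hu : ι u ∈ N) : ∃ m : ℕ, 0 < m ∧ (u : L) ^ m ∈ Subring.center L := by
    obtain ⟨m, hm, hmc⟩ := hrad _ ⟨ι u, hu, rfl⟩
    refine ⟨m, hm, Subring.mem_center_iff.2 fun g => Subtype.ext ?_⟩
    exact Subring.mem_center_iff.1 hmc g
  have hiter (k : ℕ) (g : Lˣ) :
      ι ((fun z => ⁅x', z⁆)^[k] g) = (fun z => ⁅x, z⁆)^[k] (ι g) := by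
    refine Function.Semiconj.iterate_right (f := ι) (fun z => ?_) k g
    rw [map_commutatorElement, hx']
  obtain ⟨n, hn, hxn⟩ := hcenter x' (hx'.symm ▸ hx)
  have := (hD {(x : D), y}).mem_center x' hn hxn r
    fun g => hcenter _ (by rw [hiter]; exact hr x hx _)
  exact congrArg Subtype.val (Subring.mem_center_iff.1 this ⟨y, hyL⟩)
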